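/- Let $R$ be a commutative Noetherian ring, let $M$ be a finitely generated $R$-module, and let $k \ge 0$ be an integer. All modules below are finitely generated, and $(-)^* = \operatorname{Hom}_R(-,R)$. Definitions. - If $P_1 \xrightarrow{u} P_0 \to M \to 0$ is an exact sequence with $P_0, P_1$ finitely generated projective, the Auslander dual of $M$ is $D(M) = \operatorname{Coker}(u^* : P_0^* \to P_1^*)$; up to projective direct summands it does not depend on the presentation. $M$ is *$k$-torsionless* if $\operatorname{Ext}^i_R(D(M),R) = 0$ for $i = 1,\dots,k$ (every module is $0$-torsionless). - $M$ is a *$k$-th syzygy* if there is an exact sequence $0 \to M \to P_0 \to \cdots \to P_{k-1}$ with all $P_j$ finitely generated projective (every module is a $0$-th syzygy). - A finitely generated module $G$ over a Noetherian ring $A$ has Gorenstein dimension $0$ if it is reflexive and $\operatorname{Ext}^i_A(G,A) = \operatorname{Ext}^i_A(\operatorname{Hom}_A(G,A),A) = 0$ for all $i \ge 1$. For a finitely generated $A$-module $N$, $\operatorname{gdim}_A(N)$ is the least $n \ge 0$ for which there is an exact sequence $0 \to G_n \to \cdots \to G_0 \to N \to 0$ with all $G_j$ of Gorenstein dimension $0$;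 it is $\infty$ if there is no such $n$. - The depth of a Noetherian local ring is the maximal length of a regular sequence in its maximal ideal. Theorem. Suppose that $\operatorname{gdim}_{R_P}(M_P) < \infty$ for every prime ideal $P$ of $R$ with $\operatorname{depth}(R_P) \le k-2$. Then $M$ is $k$-torsionless if and only if $M$ is a $k$-th syzygy. -/

import Mathlib

universe u v

/-- `Ext^i_R(X, R) = 0`. -/
def ExtToRingVanishes (R : Type u) [CommRing R] (X : Type u) [AddCommGroup X] [Module R X]
    (i : ℕ) : Prop :=
  Subsingleton (CategoryTheory.Abelian.Ext.{u} (ModuleCat.of R X) (ModuleCat.of R R) i)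

/-- A presentation `P₁ → P₀ → M → 0` of `M` by finitely generated projective modules.
The modules `P₁`, `P₀` are taken in the universe of `R`; every finitely generated `R`-module is
isomorphic to one there. -/
structure FGProjectivePresentation (R : Type u) [CommRing R] (M : Type v) [AddCommGroup M]
    [Module R M] where
  P₁ : ModuleCat.{u} R
  P₀ : ModuleCat.{u} R
  finite₁ : Module.Finite R P₁
  finite₀ : Module.Finite R P₀
  projective₁ : Module.Projective R P₁
  projective₀ : Module.Projective R P₀
  rel : P₁ →ₗ[R] P₀
  proj : P₀ →ₗ[R] M
  exact : Function.Exact rel proj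
  surjective : Function.Surjective proj

/-- The Auslander dual of `M` computed from a presentation: the cokernel of the dual map
`P₀* → P₁*`. -/
abbrev FGProjectivePresentation.AuslanderDual {R : Type u} [CommRing R] {M : Type v}
    [AddCommGroup M] [Module R M] (π : FGProjectivePresentation R M) : Type u :=
  Module.Dual R π.P₁ ⧸ LinearMap.range π.rel.dualMap

/-- `M` is `k`-torsionless: `Ext^i(D(M), R) = 0` for `1 ≤ i ≤ k`. The Auslander dual `D(M)` is
well defined up to projective equivalence; the vanishing is required for each of its
representatives. -/
def IsKTorsionless (R : Type u) [CommRing R] (M : Type v) [AddCommGroup M] [Module R M]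
    (k : ℕ) : Prop :=
  ∀ π : FGProjectivePresentation R M, ∀ i : ℕ, 1 ≤ i → i ≤ k →
    ExtToRingVanishes R π.AuslanderDual i

/-- `M` is a `k`-th syzygy: there is an exact sequence `0 → M → P 0 → ⋯ → P (k - 1)` of finitely
generated modules with all `P j` projective. Nothing is required of `P j` for `j ≥ k` and of the
maps into them, so that every module is a `0`-th syzygy. -/
def IsKthSyzygy (R : Type u) [CommRing R] (M : Type v) [AddCommGroup M] [Module R M]
    (k : ℕ) : Prop :=
  ∃ (P : ℕ → ModuleCat.{u} R) (f : M →ₗ[R] P 0) (d : ∀ j : ℕ, P j →ₗ[R] P (j + 1)),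
    (∀ j : ℕ, j < k → Module.Finite R (P j) ∧ Module.Projective R (P j)) ∧
    (1 ≤ k → Function.Injective f) ∧
    (2 ≤ k → Function.Exact f (d 0)) ∧
    (∀ j : ℕ, j + 3 ≤ k → Function.Exact (d j) (d (j + 1)))

/-- The finitely generated module `G` has Gorenstein dimension `0`: it is reflexive and
`Ext^i(G, R) = Ext^i(G*, R) = 0` for all `i ≥ 1`. -/
structure IsGDimZero (R : Type u) [CommRing R] (G : Type u) [AddCommGroup G] [Module R G] :
    Prop where
  finite : Module.Finite R G
  reflexive : Module.IsReflexive R G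
  ext_eq_zero : ∀ i : ℕ, 1 ≤ i → ExtToRingVanishes R G i
  ext_dual_eq_zero : ∀ i : ℕ, 1 ≤ i → ExtToRingVanishes R (Module.Dual R G) i

/-- `M` has Gorenstein dimension at most `n`: there is an exact sequence
`0 → G n → ⋯ → G 0 → M → 0` with all `G j` of Gorenstein dimension `0`. The sequence is continued
to the left by zero modules. -/
def GDimLE (R : Type u) [CommRing R] (M : Type v) [AddCommGroup M] [Module R M] (n : ℕ) : Prop :=
  ∃ (G : ℕ → ModuleCat.{u} R) (d : ∀ j : ℕ, G (j + 1) →ₗ[R] G j) (ε : G 0 →ₗ[R] M),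
    (∀ j : ℕ, j ≤ n → IsGDimZero R (G j)) ∧
    (∀ j : ℕ, n < j → Subsingleton (G j)) ∧
    Function.Surjective ε ∧
    Function.Exact (d 0) ε ∧
    (∀ j : ℕ, Function.Exact (d (j + 1)) (d j))

/-- The Gorenstein dimension of `M`: the least `n` with `GDimLE R M n`, or `⊤` if there is none. -/
noncomputable def gDim (R : Type u) [CommRing R] (M : Type v) [AddCommGroup M] [Module R M] : ℕ∞ :=
  ⨅ (n : ℕ) (_ : GDimLE R M n), (n : ℕ∞)

/-- The depth of a local ring `A`: the supremum of the lengths of the `A`-regular sequences in the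
maximal ideal. -/
noncomputable def localRingDepth (A : Type u) [CommRing A] [IsLocalRing A] : ℕ∞ :=
  ⨆ (rs : List A) (_ : RingTheory.Sequence.IsRegular A rs ∧
    ∀ r ∈ rs, r ∈ IsLocalRing.maximalIdeal A), (rs.length : ℕ∞)

open CategoryTheory

/-! Call `0 → M → F → N → 0` with `F` finite projective and `F* → M*` surjective a pushforward.
Vanishing of `Ext^1(D(M), R)` means that `M → M**` is injective, so that a pushforward exists, and
`D(N)` is then a first syzygy of `D(M)`. Hence `k`-torsionless means having `k` successive
pushforwards (`isKTorsionless_iff_hasPushforwards`), and the forward implication is immediate.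

For the converse, induct on `k`: a `(k + 1)`-th syzygy `M` already has `k` pushforwards, ending at
some `N`. Comparing this chain with the given projective one
(`hasPushforwards_succ_of_isShortExact`) yields `0 → L → Q ⊕ N → N' → 0` with `Q` projective, `N'`
inside a projective, and `L` having a projective resolution with `k` terms. Linear forms separate
points of `N'`, so `Ker(N → N**)` embeds in `L`. If `P` is an associated prime of this kernel, then
`Hom(κ(P), L_P) ≠ 0`, which forces some `Ext^i(κ(P), R_P) ≠ 0` with `i < k`, hence `depth R_P < k`
and `gdim M_P` is finite.

Let `d` be the least such `i`. Being a `d`-th syzygy, `M_P` has `Ext^i(κ(P), M_P) = 0` for `i < d`,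
and finite Gorenstein dimension then makes it of Gorenstein dimension `0` (`isGDimZero_of_gDimLE`).
So `M_P` has pushforwards of every length, `N_P → N_P**` is injective, and `P` cannot be associated
to the kernel. -/

/-- `0 → X → Y → Z → 0` is a short exact sequence of modules. -/
structure IsShortExact {R : Type*} [CommRing R] {X Y Z : Type*} [AddCommGroup X] [Module R X]
    [AddCommGroup Y] [Module R Y] [AddCommGroup Z] [Module R Z]
    (f : X →ₗ[R] Y) (g : Y →ₗ[R] Z) : Prop where
  injective : Function.Injective f
  exact : Function.Exact f g
  surjective : Function.Surjective g

/-- `Ext^i_R(X, Y) = 0`. -/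
def ExtVanishes (R : Type u) [CommRing R] (X Y : Type u) [AddCommGroup X] [Module R X]
    [AddCommGroup Y] [Module R Y] (i : ℕ) : Prop :=
  Subsingleton (Abelian.Ext.{u} (ModuleCat.of R X) (ModuleCat.of R Y) i)

/-! ### Long exact sequences for Ext, and Ext into finite projective modules -/

section ExtBasic

variable {R : Type u} [CommRing R] {X Y Z W : Type u} [AddCommGroup X] [Module R X]
  [AddCommGroup Y] [Module R Y] [AddCommGroup Z] [Module R Z] [AddCommGroup W] [Module R W]

theorem ExtVanishes.eq_zero {i : ℕ} (h : ExtVanishes R X Y i)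
    (e : Abelian.Ext.{u} (ModuleCat.of R X) (ModuleCat.of R Y) i) : e = 0 :=
  @Subsingleton.elim _ h _ _

theorem extVanishes_of_eq_zero {i : ℕ}
    (h : ∀ e : Abelian.Ext.{u} (ModuleCat.of R X) (ModuleCat.of R Y) i, e = 0) :
    ExtVanishes R X Y i :=
  subsingleton_of_forall_eq 0 h

theorem extVanishes_of_projective (R : Type u) [CommRing R] (X Y : Type u) [AddCommGroup X]
    [Module R X] [AddCommGroup Y] [Module R Y] [Module.Projective R X] {i : ℕ} (hi : 1 ≤ i) :
    ExtVanishes R X Y i := by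
  obtain ⟨i, rfl⟩ := Nat.exists_eq_add_of_le' hi
  have : Projective (ModuleCat.of R X) := (IsProjective.iff_projective X).mp inferInstance
  exact Abelian.Ext.subsingleton_of_projective _ _ i

/-- The map induced by `f` on `Ext^i(W, -)`. -/
noncomputable def extMap (W : Type u) [AddCommGroup W] [Module R W] (i : ℕ) (f : X →ₗ[R] Y) :
    Abelian.Ext.{u} (ModuleCat.of R W) (ModuleCat.of R X) i →ₗ[R]
      Abelian.Ext.{u} (ModuleCat.of R W) (ModuleCat.of R Y) i where
  toFun e := e.comp (Abelian.Ext.mk₀ (ModuleCat.ofHom f)) (add_zero i)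
  map_add' _ _ := by simp
  map_smul' _ _ := by simp

theorem extMap_apply (i : ℕ) (f : X →ₗ[R] Y)
    (e : Abelian.Ext.{u} (ModuleCat.of R W) (ModuleCat.of R X) i) :
    extMap W i f e = e.comp (Abelian.Ext.mk₀ (ModuleCat.ofHom f)) (add_zero i) := rfl

theorem extMap_comp (i : ℕ) (f : X →ₗ[R] Y) (g : Y →ₗ[R] Z)
    (e : Abelian.Ext.{u} (ModuleCat.of R W) (ModuleCat.of R X) i) :
    extMap W i (g ∘ₗ f) e = extMap W i g (extMap W i f e) := by
  simp only [extMap_apply, ModuleCat.ofHom_comp, ← Abelian.Ext.mk₀_comp_mk₀]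
  rw [Abelian.Ext.comp_assoc]
  simp

@[simp]
theorem extMap_id (i : ℕ) (e : Abelian.Ext.{u} (ModuleCat.of R W) (ModuleCat.of R X) i) :
    extMap W i (LinearMap.id : X →ₗ[R] X) e = e := by
  simp [extMap_apply]

@[simp]
theorem extMap_add (i : ℕ) (f g : X →ₗ[R] Y)
    (e : Abelian.Ext.{u} (ModuleCat.of R W) (ModuleCat.of R X) i) :
    extMap W i (f + g) e = extMap W i f e + extMap W i g e := by
  simp [extMap_apply, ModuleCat.ofHom_add, Abelian.Ext.mk₀_add]

@[simp]
theorem extMap_zero (i : ℕ) (e : Abelian.Ext.{u} (ModuleCat.of R W) (ModuleCat.of R X) i) :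
    extMap W i (0 : X →ₗ[R] Y) e = 0 := by
  simp [extMap_apply, ModuleCat.ofHom_zero, Abelian.Ext.mk₀_zero]

theorem ofHom_smul_eq (r : R) (f : X →ₗ[R] Y) :
    ModuleCat.ofHom (r • f) = r • ModuleCat.ofHom f := rfl

@[simp]
theorem extMap_smul (i : ℕ) (r : R) (f : X →ₗ[R] Y)
    (e : Abelian.Ext.{u} (ModuleCat.of R W) (ModuleCat.of R X) i) :
    extMap W i (r • f) e = r • extMap W i f e := by
  simp [extMap_apply, ofHom_smul_eq, Abelian.Ext.mk₀_smul]

theorem extMap_sum {ι : Type*} (s : Finset ι) (i : ℕ) (f : ι → X →ₗ[R] Y)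
    (e : Abelian.Ext.{u} (ModuleCat.of R W) (ModuleCat.of R X) i) :
    extMap W i (∑ j ∈ s, f j) e = ∑ j ∈ s, extMap W i (f j) e := by
  classical
  induction s using Finset.induction_on with
  | empty => simp
  | insert a s ha ih => simp [Finset.sum_insert ha, ih]

/-- Scalars act on Ext through endomorphisms of the first argument. -/
theorem ext_smul_eq_zero {r : R} (hr : ∀ w : W, r • w = 0) {i : ℕ}
    (e : Abelian.Ext.{u} (ModuleCat.of R W) (ModuleCat.of R X) i) : r • e = 0 := by
  have h : r • 𝟙 (ModuleCat.of R W) = 0 := by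
    ext w
    exact hr w
  have : r • e = (Abelian.Ext.mk₀ (r • 𝟙 (ModuleCat.of R W))).comp e (zero_add i) := by
    simp [Abelian.Ext.mk₀_smul]
  rw [this, h]
  simp

theorem extMap_injective_zero {f : X →ₗ[R] Y} (hf : Function.Injective f) :
    Function.Injective (extMap W 0 f) := by
  have : Mono (ModuleCat.ofHom f) := (ModuleCat.mono_iff_injective _).mpr hf
  exact Abelian.Ext.postcomp_mk₀_injective_of_mono (ModuleCat.of R W) (ModuleCat.ofHom f)

namespace IsShortExact

variable {f : X →ₗ[R] Y} {g : Y →ₗ[R] Z}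

/-- The short complex of a short exact sequence. -/
abbrev shortComplex (h : IsShortExact f g) : ShortComplex (ModuleCat.{u} R) :=
  ShortComplex.mk (ModuleCat.ofHom f) (ModuleCat.ofHom g) (by
    ext x
    exact h.exact.apply_apply_eq_zero x)

theorem shortExact (h : IsShortExact f g) : h.shortComplex.ShortExact where
  exact := (ShortComplex.ShortExact.moduleCat_exact_iff_function_exact _).mpr h.exact
  mono_f := (ModuleCat.mono_iff_injective _).mpr h.injective
  epi_g := (ModuleCat.epi_iff_surjective _).mpr h.surjective

theorem extVanishes_left_of_middle_of_right (h : IsShortExact f g) {i : ℕ}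
    (hY : ExtVanishes R Y W i) (hZ : ExtVanishes R Z W (i + 1)) : ExtVanishes R X W i := by
  refine extVanishes_of_eq_zero fun x => ?_
  obtain ⟨y, hy⟩ := Abelian.Ext.contravariant_sequence_exact₁ h.shortExact (ModuleCat.of R W) x
    (add_comm 1 i) (hZ.eq_zero _)
  rw [← hy, hY.eq_zero y, Abelian.Ext.comp_zero]

theorem extVanishes_right_of_left_of_middle (h : IsShortExact f g) {i : ℕ}
    (hX : ExtVanishes R X W i) (hY : ExtVanishes R Y W (i + 1)) : ExtVanishes R Z W (i + 1) := by
  refine extVanishes_of_eq_zero fun z => ?_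
  obtain ⟨x, hx⟩ := Abelian.Ext.contravariant_sequence_exact₃ h.shortExact (ModuleCat.of R W) z
    (hY.eq_zero _) (add_comm 1 i)
  rw [← hx, hX.eq_zero x, Abelian.Ext.comp_zero]

theorem exists_extension (h : IsShortExact f g) (hZ : ExtVanishes R Z W 1) (φ : X →ₗ[R] W) :
    ∃ ψ : Y →ₗ[R] W, ψ ∘ₗ f = φ := by
  obtain ⟨y, hy⟩ := Abelian.Ext.contravariant_sequence_exact₁ h.shortExact (ModuleCat.of R W)
    (Abelian.Ext.mk₀ (ModuleCat.ofHom φ)) (add_zero 1) (hZ.eq_zero _)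
  obtain ⟨y, rfl⟩ := (Abelian.Ext.mk₀_bijective _ _).2 y
  rw [Abelian.Ext.mk₀_comp_mk₀, (Abelian.Ext.mk₀_bijective _ _).1.eq_iff] at hy
  exact ⟨y.hom, congrArg ModuleCat.Hom.hom hy⟩

/-- Every class in `Ext^1(Z, W)` is the image of a map `X → W` under the connecting map, which kills
the maps that extend to `Y`. -/
theorem extVanishes_one_right (h : IsShortExact f g) (hY : ExtVanishes R Y W 1)
    (hext : ∀ φ : X →ₗ[R] W, ∃ ψ : Y →ₗ[R] W, ψ ∘ₗ f = φ) : ExtVanishes R Z W 1 := by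
  refine extVanishes_of_eq_zero fun z => ?_
  obtain ⟨x, hx⟩ := Abelian.Ext.contravariant_sequence_exact₃ h.shortExact (ModuleCat.of R W) z
    (hY.eq_zero _) (add_zero 1)
  obtain ⟨x, rfl⟩ := (Abelian.Ext.mk₀_bijective _ _).2 x
  obtain ⟨ψ, hψ⟩ := hext x.hom
  have : x = ModuleCat.ofHom f ≫ ModuleCat.ofHom ψ := by
    ext1
    exact hψ.symm
  rw [← hx, this, ← Abelian.Ext.mk₀_comp_mk₀]
  exact h.shortExact.extClass_comp_assoc _

theorem extVanishes_to_left (h : IsShortExact f g) {i : ℕ}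
    (hZ : ExtVanishes R W Z i) (hY : ExtVanishes R W Y (i + 1)) : ExtVanishes R W X (i + 1) := by
  refine extVanishes_of_eq_zero fun x => ?_
  obtain ⟨z, hz⟩ := Abelian.Ext.covariant_sequence_exact₁ (ModuleCat.of R W) h.shortExact x
    (hY.eq_zero _) rfl
  rw [← hz, hZ.eq_zero z, Abelian.Ext.zero_comp]

theorem extVanishes_to_right (h : IsShortExact f g) {i : ℕ}
    (hY : ExtVanishes R W Y i) (hX : ExtVanishes R W X (i + 1)) : ExtVanishes R W Z i := by
  refine extVanishes_of_eq_zero fun z => ?_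
  obtain ⟨y, hy⟩ := Abelian.Ext.covariant_sequence_exact₃ (ModuleCat.of R W) h.shortExact z
    rfl (hX.eq_zero _)
  rw [← hy, hY.eq_zero y, Abelian.Ext.zero_comp]

theorem extMap_injective_succ (h : IsShortExact f g) {i : ℕ} (hZ : ExtVanishes R W Z i) :
    Function.Injective (extMap W (i + 1) f) := by
  refine (injective_iff_map_eq_zero _).mpr fun x hx => ?_
  obtain ⟨z, hz⟩ := Abelian.Ext.covariant_sequence_exact₁ (ModuleCat.of R W) h.shortExact x hx rfl
  rw [← hz, hZ.eq_zero z, Abelian.Ext.zero_comp]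

theorem extMap_exact (h : IsShortExact f g) (i : ℕ) :
    Function.Exact (extMap W i f) (extMap W i g) := by
  intro y
  constructor
  · intro hy
    exact Abelian.Ext.covariant_sequence_exact₂ (ModuleCat.of R W) h.shortExact y hy
  · rintro ⟨x, rfl⟩
    rw [← extMap_comp, h.exact.linearMap_comp_eq_zero, extMap_zero]

end IsShortExact

theorem extVanishes_zero_of_injective {f : X →ₗ[R] Y} (hf : Function.Injective f)
    (h : ExtVanishes R W Y 0) : ExtVanishes R W X 0 :=
  extVanishes_of_eq_zero fun x => extMap_injective_zero hf
    (by rw [h.eq_zero (extMap W 0 f x), map_zero])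

theorem extVanishes_zero_iff : ExtVanishes R X Y 0 ↔ ∀ φ : X →ₗ[R] Y, φ = 0 := by
  constructor
  · intro h φ
    have := h.eq_zero (Abelian.Ext.mk₀ (ModuleCat.ofHom φ))
    rw [← Abelian.Ext.mk₀_zero, (Abelian.Ext.mk₀_bijective _ _).1.eq_iff] at this
    exact congrArg ModuleCat.Hom.hom this
  · intro h
    refine extVanishes_of_eq_zero fun x => ?_
    obtain ⟨x, rfl⟩ := (Abelian.Ext.mk₀_bijective _ _).2 x
    have : x = 0 := by
      ext1
      exact h x.hom
    rw [this, Abelian.Ext.mk₀_zero]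

/-- Elements of `Ext^i(W, P)` with `P` finite projective are detected by linear forms on `P`. -/
theorem eq_zero_of_forall_extMap_eq_zero {P : Type u} [AddCommGroup P] [Module R P]
    [Module.Finite R P] [Module.Projective R P] {i : ℕ}
    (x : Abelian.Ext.{u} (ModuleCat.of R W) (ModuleCat.of R P) i)
    (h : ∀ φ : P →ₗ[R] R, extMap W i φ x = 0) : x = 0 := by
  obtain ⟨n, p, s, -, -, hps⟩ := Module.Finite.exists_comp_eq_id_of_projective R P
  have hs : s = ∑ j, LinearMap.single R (fun _ => R) j ∘ₗ (LinearMap.proj j ∘ₗ s) := by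
    ext a b
    simp [Pi.single_apply]
  have h0 : extMap W i s x = 0 := by
    rw [hs, extMap_sum]
    exact Finset.sum_eq_zero fun j _ => by rw [extMap_comp, h, map_zero]
  have : extMap W i (p ∘ₗ s) x = x := by simp [hps]
  rw [← this, extMap_comp, h0, map_zero]

/-- Vanishing of `Ext^i(W, -)` passes from the ring to finite projective modules. -/
theorem ExtVanishes.of_ring {i : ℕ} (h : ExtVanishes R W R i) (P : Type u) [AddCommGroup P]
    [Module R P] [Module.Finite R P] [Module.Projective R P] : ExtVanishes R W P i :=
  extVanishes_of_eq_zero fun x => eq_zero_of_forall_extMap_eq_zero x fun _ => h.eq_zero _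

/-- Linear maps from `P*` to `Ext^i(W, R)` are given by elements of `Ext^i(W, P)` for `P` finite
projective. -/
theorem exists_forall_extMap_eq {P : Type u} [AddCommGroup P] [Module R P] [Module.Finite R P]
    [Module.Projective R P] {i : ℕ}
    (ψ : Module.Dual R P →ₗ[R] Abelian.Ext.{u} (ModuleCat.of R W) (ModuleCat.of R R) i) :
    ∃ x : Abelian.Ext.{u} (ModuleCat.of R W) (ModuleCat.of R P) i,
      ∀ φ : P →ₗ[R] R, extMap W i φ x = ψ φ := by
  obtain ⟨n, p, s, -, -, hps⟩ := Module.Finite.exists_comp_eq_id_of_projective R P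
  -- Dual basis: the vectors `p (e_j)` and the forms `proj j ∘ s` express every `φ` in terms of its
  -- values, as in `h1`.
  refine ⟨∑ j, extMap W i (LinearMap.toSpanSingleton R P (p (Pi.single j 1)))
    (ψ (LinearMap.proj j ∘ₗ s)), fun φ => ?_⟩
  have h1 : φ = ∑ j, φ (p (Pi.single j 1)) • (LinearMap.proj j ∘ₗ s) := by
    ext x
    have hx : p (s x) = x := LinearMap.congr_fun hps x
    have hsx : s x = ∑ j, s x j • Pi.single j (1 : R) := by
      ext k
      simp [Pi.single_apply]
    conv_lhs => rw [← hx, hsx]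
    simp [mul_comm]
  have h2 : ∀ y : P, φ ∘ₗ LinearMap.toSpanSingleton R P y = φ y • LinearMap.id := by
    intro y
    ext
    simp
  conv_rhs => rw [h1]
  rw [map_sum, map_sum]
  refine Finset.sum_congr rfl fun j _ => ?_
  rw [← extMap_comp, h2, extMap_smul, extMap_id, map_smul]

end ExtBasic

/-! ### Factoring through surjections, and dual sequences -/

section Factor

variable {R : Type*} [CommRing R] {X Y Z : Type*} [AddCommGroup X] [Module R X]
  [AddCommGroup Y] [Module R Y] [AddCommGroup Z] [Module R Z]

theorem exists_comp_eq_of_surjective {g : X →ₗ[R] Y} (hg : Function.Surjective g) (ψ : X →ₗ[R] Z)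
    (h : ∀ x, g x = 0 → ψ x = 0) : ∃ φ : Y →ₗ[R] Z, φ ∘ₗ g = ψ := by
  refine ⟨(LinearMap.ker g).liftQ ψ h ∘ₗ (g.quotKerEquivOfSurjective hg).symm.toLinearMap, ?_⟩
  ext x
  have : (g.quotKerEquivOfSurjective hg).symm (g x) = (LinearMap.ker g).mkQ x := by
    rw [LinearEquiv.symm_apply_eq]
    rfl
  rw [LinearMap.comp_apply, LinearMap.comp_apply, LinearEquiv.coe_coe, this]
  rfl

theorem isShortExact_range_mkQ {f : X →ₗ[R] Y} (hf : Function.Injective f) :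
    IsShortExact f (LinearMap.range f).mkQ where
  injective := hf
  exact := LinearMap.exact_map_mkQ_range f
  surjective := Submodule.mkQ_surjective _

theorem isShortExact_subtype_mkQ (S : Submodule R X) : IsShortExact S.subtype S.mkQ where
  injective := S.injective_subtype
  exact := LinearMap.exact_subtype_mkQ S
  surjective := Submodule.mkQ_surjective _

theorem isShortExact_ker_subtype {g : X →ₗ[R] Y} (hg : Function.Surjective g) :
    IsShortExact (LinearMap.ker g).subtype g where
  injective := Submodule.injective_subtype _
  exact := LinearMap.exact_subtype_ker_map g
  surjective := hg

theorem IsShortExact.dual {f : X →ₗ[R] Y} {g : Y →ₗ[R] Z} (h : IsShortExact f g)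
    (hf : Function.Surjective f.dualMap) : IsShortExact g.dualMap f.dualMap where
  injective := LinearMap.dualMap_injective_of_surjective h.surjective
  exact := by
    intro ψ
    constructor
    · intro hψ
      obtain ⟨φ, hφ⟩ := exists_comp_eq_of_surjective h.surjective ψ fun x hx => by
        obtain ⟨x, rfl⟩ := (h.exact x).mp hx
        exact LinearMap.congr_fun hψ x
      exact ⟨φ, hφ⟩
    · rintro ⟨φ, rfl⟩
      ext x
      simp [h.exact.apply_apply_eq_zero]
  surjective := hf

end Factor

/-! ### The Auslander dual and pushforwards -/

section Auslander

variable {R : Type u} [CommRing R] {M : Type v} [AddCommGroup M] [Module R M]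

/-- `Ext^1(D(M), R) = 0` exactly when `M → M**` is injective. -/
theorem extVanishes_one_auslanderDual_iff (π : FGProjectivePresentation R M) :
    ExtVanishes R π.AuslanderDual R 1 ↔ Function.Injective (Module.Dual.eval R M) := by
  have := π.finite₁
  have := π.finite₀
  have := π.projective₁
  have := π.projective₀
  have hS := isShortExact_subtype_mkQ (LinearMap.range π.rel.dualMap)
  rw [injective_iff_map_eq_zero]
  constructor
  · intro h m hm
    obtain ⟨p, rfl⟩ := π.surjective m
    have hp : ∀ ψ, π.rel.dualMap.rangeRestrict ψ = 0 → Module.Dual.eval R π.P₀ p ψ = 0 := by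
      intro ψ hψ
      obtain ⟨φ, rfl⟩ := exists_comp_eq_of_surjective π.surjective ψ fun x hx => by
        obtain ⟨x, rfl⟩ := (π.exact x).mp hx
        exact LinearMap.congr_fun (congrArg Subtype.val hψ) x
      exact LinearMap.congr_fun hm φ
    -- Evaluation at `p` descends to the image of `P₀* → P₁*`. An extension to `P₁*` is evaluation
    -- at some `q`, and then `p = rel q` dies in `M`.
    obtain ⟨l, hl⟩ := exists_comp_eq_of_surjective (X := Module.Dual R π.P₀)
      (Y := LinearMap.range π.rel.dualMap) (Z := R) (g := π.rel.dualMap.rangeRestrict)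
      π.rel.dualMap.surjective_rangeRestrict (Module.Dual.eval R π.P₀ p) hp
    obtain ⟨L, hL⟩ := hS.exists_extension h l
    obtain ⟨q, rfl⟩ := (Module.bijective_dual_eval R π.P₁).2 L
    have : p = π.rel q := by
      apply (Module.bijective_dual_eval R π.P₀).1
      ext ψ
      rw [← hl, ← hL]
      rfl
    rw [this, π.exact.apply_apply_eq_zero]
  · intro h
    refine hS.extVanishes_one_right (extVanishes_of_projective R _ _ le_rfl) fun l => ?_
    obtain ⟨p, hp⟩ := (Module.bijective_dual_eval R π.P₀).2 (l ∘ₗ π.rel.dualMap.rangeRestrict)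
    have hp0 : π.proj p = 0 := by
      apply h
      ext φ
      have h1 := LinearMap.congr_fun hp (φ ∘ₗ π.proj)
      have h2 : π.rel.dualMap.rangeRestrict (φ ∘ₗ π.proj) = 0 := by
        ext x
        simp [LinearMap.dualMap_apply, π.exact.apply_apply_eq_zero]
      rw [LinearMap.comp_apply, h2, map_zero] at h1
      exact h1
    obtain ⟨q, rfl⟩ := (π.exact p).mp hp0
    refine ⟨Module.Dual.eval R π.P₁ q, ?_⟩
    ext ⟨_, ψ, rfl⟩
    exact LinearMap.congr_fun hp ψ

/-- The presentation of the cokernel `N` of `M → F` obtained from a presentation of `M`. -/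
abbrev FGProjectivePresentation.pushforward (π : FGProjectivePresentation R M)
    {F : ModuleCat.{u} R} {N : Type u} [AddCommGroup N] [Module R N] [Module.Finite R F]
    [Module.Projective R F] {f : M →ₗ[R] F} {g : F →ₗ[R] N} (h : IsShortExact f g) :
    FGProjectivePresentation R N where
  P₁ := π.P₀
  P₀ := F
  finite₁ := π.finite₀
  finite₀ := inferInstance
  projective₁ := π.projective₀
  projective₀ := inferInstance
  rel := f ∘ₗ π.proj
  proj := g
  exact := by
    intro x
    rw [h.exact x, LinearMap.coe_comp, π.surjective.range_comp]
  surjective := h.surjective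

/-- The Auslander dual of a pushforward of `M` is the first syzygy of the Auslander dual of `M`. -/
theorem extVanishes_pushforward_iff (π : FGProjectivePresentation R M)
    {F : ModuleCat.{u} R} {N : Type u} [AddCommGroup N] [Module R N] [Module.Finite R F]
    [Module.Projective R F] {f : M →ₗ[R] F} {g : F →ₗ[R] N} (h : IsShortExact f g)
    (hf : Function.Surjective f.dualMap) {i : ℕ} (hi : 1 ≤ i) :
    ExtVanishes R (π.pushforward h).AuslanderDual R i ↔
      ExtVanishes R π.AuslanderDual R (i + 1) := by
  have := π.finite₁
  have := π.projective₁
  let a : (π.pushforward h).AuslanderDual →ₗ[R] Module.Dual R π.P₁ :=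
    (LinearMap.range (π.pushforward h).rel.dualMap).liftQ π.rel.dualMap (by
      rintro _ ⟨φ, rfl⟩
      ext x
      simp [LinearMap.dualMap_apply, π.exact.apply_apply_eq_zero])
  have ha : IsShortExact a (LinearMap.range π.rel.dualMap).mkQ :=
    { injective := by
        rw [← LinearMap.ker_eq_bot, Submodule.ker_liftQ_eq_bot]
        intro ψ hψ
        obtain ⟨φ, rfl⟩ := exists_comp_eq_of_surjective π.surjective ψ fun x hx => by
          obtain ⟨x, rfl⟩ := (π.exact x).mp hx
          exact LinearMap.congr_fun hψ x
        -- Surjectivity of `F* → M*` is what makes `a` injective.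
        obtain ⟨χ, rfl⟩ := hf φ
        exact ⟨χ, rfl⟩
      exact := by
        rw [LinearMap.exact_iff, Submodule.ker_mkQ, Submodule.range_liftQ]
      surjective := Submodule.mkQ_surjective _ }
  have h1 := extVanishes_of_projective R (Module.Dual R π.P₁) R hi
  have h2 := extVanishes_of_projective R (Module.Dual R π.P₁) R (hi.trans i.le_succ)
  exact ⟨fun h => ha.extVanishes_right_of_left_of_middle h h2,
    fun h => ha.extVanishes_left_of_middle_of_right h1 h⟩

end Auslander

/-! ### Torsionlessness and syzygies as chains of short exact sequences -/

/-- A short exact sequence `0 → M → F → N → 0` with `F` finite projective and `F* → M*`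
surjective. -/
structure IsPushforward {R : Type u} [CommRing R] {M F N : Type*} [AddCommGroup M] [Module R M]
    [AddCommGroup F] [Module R F] [AddCommGroup N] [Module R N] (f : M →ₗ[R] F) (g : F →ₗ[R] N) :
    Prop extends IsShortExact f g where
  finite : Module.Finite R F
  projective : Module.Projective R F
  dual_surjective : Function.Surjective f.dualMap

/-- `M` embeds into a chain of `k` successive pushforwards. -/
def HasPushforwards (R : Type u) [CommRing R] : ℕ → ModuleCat.{u} R → Prop
  | 0, _ => True
  | k + 1, M => ∃ (F N : ModuleCat.{u} R) (f : M →ₗ[R] F) (g : F →ₗ[R] N),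
      IsPushforward f g ∧ HasPushforwards R k N

/-- `M` embeds into a chain of `k` finite projective modules. -/
def HasCosyzygies (R : Type u) [CommRing R] : ℕ → ModuleCat.{u} R → Prop
  | 0, _ => True
  | k + 1, M => ∃ (F N : ModuleCat.{u} R) (f : M →ₗ[R] F) (g : F →ₗ[R] N),
      IsShortExact f g ∧ Module.Finite R F ∧ Module.Projective R F ∧ HasCosyzygies R k N

section Pushforward

variable {R : Type u} [CommRing R]

theorem HasPushforwards.hasCosyzygies {k : ℕ} : ∀ {M : ModuleCat.{u} R},
    HasPushforwards R k M → HasCosyzygies R k M := by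
  induction k with
  | zero => exact fun _ => trivial
  | succ k ih =>
    rintro M ⟨F, N, f, g, h, hN⟩
    exact ⟨F, N, f, g, h.toIsShortExact, h.finite, h.projective, ih hN⟩

theorem HasCosyzygies.of_succ {k : ℕ} : ∀ {M : ModuleCat.{u} R},
    HasCosyzygies R (k + 1) M → HasCosyzygies R k M := by
  induction k with
  | zero => exact fun _ => trivial
  | succ k ih =>
    rintro M ⟨F, N, f, g, h, h1, h2, hN⟩
    exact ⟨F, N, f, g, h, h1, h2, ih hN⟩

theorem HasCosyzygies.mono {k l : ℕ} (hkl : k ≤ l) {M : ModuleCat.{u} R}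
    (h : HasCosyzygies R l M) : HasCosyzygies R k M := by
  induction l, hkl using Nat.le_induction with
  | base => exact h
  | succ l _ ih => exact ih h.of_succ

theorem IsPushforward.eval_injective {M F N : Type*} [AddCommGroup M] [Module R M]
    [AddCommGroup F] [Module R F] [AddCommGroup N] [Module R N] {f : M →ₗ[R] F} {g : F →ₗ[R] N}
    (h : IsPushforward f g) : Function.Injective (Module.Dual.eval R M) := by
  have := h.finite
  have := h.projective
  refine (injective_iff_map_eq_zero _).mpr fun m hm => h.injective ?_
  apply (Module.bijective_dual_eval R F).1
  ext φ
  simpa using LinearMap.congr_fun hm (φ ∘ₗ f)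

/-- Finitely many generators of `M*` are the coordinates of a map `M → R^n`. All forms on `M` then
extend, and the map is injective because forms separate points. -/
theorem exists_isPushforward [IsNoetherianRing R] (M : ModuleCat.{u} R) [Module.Finite R M]
    (hM : Function.Injective (Module.Dual.eval R M)) :
    ∃ (F N : ModuleCat.{u} R) (f : M →ₗ[R] F) (g : F →ₗ[R] N), IsPushforward f g := by
  have : Module.Finite R (Module.Dual R M) :=
    Module.IsNoetherian.finite R (M →ₗ[R] R)
  obtain ⟨n, p, hp⟩ := Module.Finite.exists_fin' R (Module.Dual R M)
  let f : M →ₗ[R] (Fin n → R) := LinearMap.pi fun i => p (Pi.single i 1)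
  have hf : Function.Surjective f.dualMap := by
    intro φ
    obtain ⟨a, rfl⟩ := hp φ
    refine ⟨Fintype.linearCombination R a, ?_⟩
    have : a = ∑ i, a i • Pi.single i 1 := by
      ext j
      simp [Pi.single_apply]
    conv_rhs => rw [this]
    ext m
    simp [LinearMap.dualMap_apply, f, Fintype.linearCombination_apply, mul_comm]
  have hinj : Function.Injective f := by
    refine (injective_iff_map_eq_zero _).mpr fun m hm => hM ?_
    ext φ
    obtain ⟨χ, rfl⟩ := hf φ
    simp [LinearMap.dualMap_apply, hm]
  exact ⟨ModuleCat.of R (Fin n → R), ModuleCat.of R ((Fin n → R) ⧸ LinearMap.range f), f, _,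
    { isShortExact_range_mkQ hinj with
      finite := inferInstanceAs (Module.Finite R (Fin n → R))
      projective := inferInstanceAs (Module.Projective R (Fin n → R))
      dual_surjective := hf }⟩

theorem IsShortExact.finite_right {M F N : Type*} [AddCommGroup M] [Module R M]
    [AddCommGroup F] [Module R F] [AddCommGroup N] [Module R N] {f : M →ₗ[R] F} {g : F →ₗ[R] N}
    (h : IsShortExact f g) [Module.Finite R F] : Module.Finite R N :=
  Module.Finite.of_surjective g h.surjective

theorem hasPushforwards_of_extVanishes [IsNoetherianRing R] {k : ℕ} : ∀ {M : ModuleCat.{u} R}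
    [Module.Finite R M] (π : FGProjectivePresentation R M),
    (∀ i, 1 ≤ i → i ≤ k → ExtVanishes R π.AuslanderDual R i) → HasPushforwards R k M := by
  induction k with
  | zero => exact fun _ _ => trivial
  | succ k ih =>
    intro M _ π h
    obtain ⟨F, N, f, g, hf⟩ := exists_isPushforward M
      ((extVanishes_one_auslanderDual_iff π).mp (h 1 le_rfl (by lia)))
    have := hf.finite
    have := hf.projective
    have := hf.finite_right
    refine ⟨F, N, f, g, hf, ih (π.pushforward hf.toIsShortExact) fun i hi hik => ?_⟩
    exact (extVanishes_pushforward_iff π hf.toIsShortExact hf.dual_surjective hi).mpr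
      (h _ (by lia) (by lia))

theorem HasPushforwards.extVanishes {k : ℕ} : ∀ {M : ModuleCat.{u} R}, HasPushforwards R k M →
    ∀ (π : FGProjectivePresentation R M) (i : ℕ), 1 ≤ i → i ≤ k →
      ExtVanishes R π.AuslanderDual R i := by
  induction k with
  | zero => exact fun _ _ i hi hik => absurd hi (by lia)
  | succ k ih =>
    rintro M ⟨F, N, f, g, hf, hN⟩ π i hi hik
    have := hf.finite
    have := hf.projective
    rcases hi.eq_or_lt with rfl | hi
    · exact (extVanishes_one_auslanderDual_iff π).mpr hf.eval_injective
    · obtain ⟨i, rfl⟩ := Nat.exists_eq_add_of_le' hi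
      rw [← extVanishes_pushforward_iff π hf.toIsShortExact hf.dual_surjective (by lia)]
      exact ih hN _ _ (by lia) (by lia)

theorem exists_fgProjectivePresentation [IsNoetherianRing R] (M : Type v) [AddCommGroup M]
    [Module R M] [Module.Finite R M] : Nonempty (FGProjectivePresentation R M) := by
  obtain ⟨n, p, hp⟩ := Module.Finite.exists_fin' R M
  obtain ⟨m, q, hq⟩ := Module.Finite.exists_fin' R (LinearMap.ker p)
  exact ⟨{
    P₁ := ModuleCat.of R (Fin m → R)
    P₀ := ModuleCat.of R (Fin n → R)
    finite₁ := inferInstanceAs (Module.Finite R (Fin m → R))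
    finite₀ := inferInstanceAs (Module.Finite R (Fin n → R))
    projective₁ := inferInstanceAs (Module.Projective R (Fin m → R))
    projective₀ := inferInstanceAs (Module.Projective R (Fin n → R))
    rel := (LinearMap.ker p).subtype ∘ₗ q
    proj := p
    exact := by
      rw [LinearMap.exact_iff]
      exact ((LinearMap.range_comp_of_range_eq_top _ (LinearMap.range_eq_top.mpr hq)).trans
        (Submodule.range_subtype _)).symm
    surjective := hp }⟩

theorem isKTorsionless_iff_hasPushforwards [IsNoetherianRing R] (M : ModuleCat.{u} R)
    [Module.Finite R M] (k : ℕ) : IsKTorsionless R M k ↔ HasPushforwards R k M := by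
  constructor
  · intro h
    obtain ⟨π⟩ := exists_fgProjectivePresentation (R := R) M
    exact hasPushforwards_of_extVanishes π (h π)
  · exact fun h π => h.extVanishes π

/-- The number of successive pushforwards does not depend on the choice of the first one. -/
theorem HasPushforwards.of_isPushforward [IsNoetherianRing R] {k : ℕ} {M F N : ModuleCat.{u} R}
    [Module.Finite R M] (hM : HasPushforwards R (k + 1) M) {f : M →ₗ[R] F} {g : F →ₗ[R] N}
    (hf : IsPushforward f g) : HasPushforwards R k N := by
  have := hf.finite
  have := hf.projective
  have := hf.finite_right
  obtain ⟨π⟩ := exists_fgProjectivePresentation (R := R) M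
  refine hasPushforwards_of_extVanishes (π.pushforward hf.toIsShortExact) fun i hi hik => ?_
  rw [extVanishes_pushforward_iff π hf.toIsShortExact hf.dual_surjective hi]
  exact hM.extVanishes π _ (by lia) (by lia)

theorem IsKthSyzygy.hasCosyzygies {k : ℕ} : ∀ {M : ModuleCat.{u} R},
    IsKthSyzygy R M k → HasCosyzygies R k M := by
  induction k with
  | zero => exact fun _ => trivial
  | succ k ih =>
    rintro M ⟨P, f, d, hP, h1, h2, h3⟩
    refine ⟨P 0, ModuleCat.of R (P 0 ⧸ LinearMap.range f), f, _,
      isShortExact_range_mkQ (h1 (by lia)), (hP 0 (by lia)).1, (hP 0 (by lia)).2, ?_⟩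
    rcases k with _ | k
    · trivial
    have hfd := h2 (by lia)
    refine ih ⟨fun j => P (j + 1), (LinearMap.range f).liftQ (d 0) hfd.linearMap_ker_eq.ge,
      fun j => d (j + 1), fun j hj => hP _ (by lia), fun _ => ?_, fun _ => ?_,
      fun j hj => h3 _ (by lia)⟩
    · rw [← LinearMap.ker_eq_bot, Submodule.ker_liftQ_eq_bot]
      exact hfd.linearMap_ker_eq.le
    · have := (h3 0 (by lia)).linearMap_ker_eq
      rw [LinearMap.exact_iff, Submodule.range_liftQ]
      exact this

theorem HasCosyzygies.isKthSyzygy {k : ℕ} : ∀ {M : ModuleCat.{u} R},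
    HasCosyzygies R k M → IsKthSyzygy R M k := by
  induction k with
  | zero =>
    exact fun _ => ⟨fun _ => ModuleCat.of R PUnit, 0, fun _ => 0, by lia, by lia, by lia, by lia⟩
  | succ k ih =>
    rintro M ⟨F, N, f, g, hf, h1, h2, hN⟩
    obtain ⟨P, f', d, hP, e1, e2, e3⟩ := ih hN
    refine ⟨fun j => match j with
      | 0 => F
      | j + 1 => P j, f, fun j => match j with
      | 0 => f' ∘ₗ g
      | j + 1 => d j, ?_, fun _ => hf.injective, ?_, ?_⟩
    · rintro (_ | j) hj
      · exact ⟨h1, h2⟩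
      · exact hP j (by lia)
    · intro hk
      exact (Function.Injective.comp_exact_iff_exact (i := f') (e1 (by lia))).mpr hf.exact
    · rintro (_ | j) hj
      · exact (Function.Surjective.comp_exact_iff_exact (p := g) hf.surjective).mpr (e2 (by lia))
      · exact e3 j (by lia)

variable {M : Type v} [AddCommGroup M] [Module R M] {M' : Type*} [AddCommGroup M'] [Module R M']

theorem IsKTorsionless.of_linearEquiv {k : ℕ} (e : M ≃ₗ[R] M') (h : IsKTorsionless R M k) :
    IsKTorsionless R M' k := by
  intro π
  exact h {
    P₁ := π.P₁
    P₀ := π.P₀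
    finite₁ := π.finite₁
    finite₀ := π.finite₀
    projective₁ := π.projective₁
    projective₀ := π.projective₀
    rel := π.rel
    proj := e.symm.toLinearMap ∘ₗ π.proj
    exact := (Function.Injective.comp_exact_iff_exact (i := e.symm.toLinearMap)
      e.symm.injective).mpr π.exact
    surjective := e.symm.surjective.comp π.surjective }

theorem IsKthSyzygy.of_linearEquiv {k : ℕ} (e : M ≃ₗ[R] M') (h : IsKthSyzygy R M k) :
    IsKthSyzygy R M' k := by
  obtain ⟨P, f, d, hP, h1, h2, h3⟩ := h
  exact ⟨P, f ∘ₗ e.symm.toLinearMap, d, hP, fun hk => (h1 hk).comp e.symm.injective,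
    fun hk => (Function.Surjective.comp_exact_iff_exact (p := e.symm.toLinearMap)
      e.symm.surjective).mpr (h2 hk), h3⟩

end Pushforward

/-! ### Dimension shifting, regular sequences and depth -/

/-- `L` has a finite projective resolution with `j` terms. -/
def HasResolution (R : Type u) [CommRing R] : ℕ → ModuleCat.{u} R → Prop
  | 0, L => Subsingleton L
  | j + 1, L => ∃ (K F : ModuleCat.{u} R) (f : K →ₗ[R] F) (g : F →ₗ[R] L),
      IsShortExact f g ∧ Module.Finite R F ∧ Module.Projective R F ∧ HasResolution R j K

section Depth

open Pointwise

variable {R : Type u} [CommRing R] {W : Type u} [AddCommGroup W] [Module R W]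

/-- Each term of the resolution raises the degree by one, so `Ext^i(W, L)` is controlled by
`Ext^l(W, R)` for `i ≤ l < i + j`. -/
theorem HasResolution.extVanishes {j : ℕ} : ∀ {L : ModuleCat.{u} R}, HasResolution R j L →
    ∀ i, (∀ l < i + j, ExtVanishes R W R l) → ExtVanishes R W L i := by
  induction j with
  | zero =>
    intro L hL i _
    have : Subsingleton L := hL
    refine extVanishes_of_eq_zero fun x => ?_
    have hid : (LinearMap.id : L →ₗ[R] L) = 0 := LinearMap.ext fun _ => Subsingleton.elim _ _
    have : extMap W i (LinearMap.id : L →ₗ[R] L) x = x := extMap_id i x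
    rw [← this, hid, extMap_zero]
  | succ j ih =>
    rintro L ⟨K, F, f, g, h, _, _, hK⟩ i hi
    exact h.extVanishes_to_right ((hi i (by lia)).of_ring F)
      (ih hK (i + 1) fun l hl => hi l (by lia))

theorem IsShortExact.forall_extVanishes_left {X Y Z : Type u} [AddCommGroup X] [Module R X]
    [AddCommGroup Y] [Module R Y] [AddCommGroup Z] [Module R Z] {f : X →ₗ[R] Y} {g : Y →ₗ[R] Z}
    (h : IsShortExact f g) {t : ℕ} (hY : ∀ i < t, ExtVanishes R W Y i)
    (hZ : ∀ i, i + 1 < t → ExtVanishes R W Z i) : ∀ i < t, ExtVanishes R W X i := by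
  rintro (_ | i) hi
  · exact extVanishes_zero_of_injective h.injective (hY 0 hi)
  · exact h.extVanishes_to_left (hZ i (by lia)) (hY _ hi)

theorem HasCosyzygies.extVanishes {t : ℕ} : ∀ {M : ModuleCat.{u} R}, HasCosyzygies R t M →
    (∀ i < t, ExtVanishes R W R i) → ∀ i < t, ExtVanishes R W M i := by
  induction t with
  | zero => exact fun _ _ i hi => absurd hi (by lia)
  | succ t ih =>
    rintro M ⟨F, N, f, g, h, _, _, hN⟩ hR
    exact h.forall_extVanishes_left (fun i hi => (hR i hi).of_ring F)
      fun i hi => ih hN (fun i hi => hR i (by lia)) i (by lia)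

/-- Rees' argument: multiplication by `r` on `Ext^(i+1)(W, Y)` is injective because `Ext^i(W, Y/rY)
= 0`, and it is zero because `r` kills `W`. -/
theorem extVanishes_of_isWeaklyRegular (rs : List R) (hW : ∀ r ∈ rs, ∀ w : W, r • w = 0)
    (Y : Type u) [AddCommGroup Y] [Module R Y] (h : RingTheory.Sequence.IsWeaklyRegular Y rs) :
    ∀ i < rs.length, ExtVanishes R W Y i := by
  induction rs generalizing Y with
  | nil => exact fun i hi => absurd hi (by simp)
  | cons r rs ih =>
    rw [RingTheory.Sequence.isWeaklyRegular_cons_iff] at h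
    have hr : ∀ w : W, r • w = 0 := hW r (by simp)
    have hS : IsShortExact (LinearMap.lsmul R Y r) (r • (⊤ : Submodule R Y)).mkQ :=
      { injective := h.1
        exact := LinearMap.exact_lsmul_mkQ_smul_top Y r
        surjective := Submodule.mkQ_surjective _ }
    rintro (_ | i) hi
    · refine extVanishes_zero_iff.mpr fun φ => LinearMap.ext fun w => h.1 ?_
      simp [← map_smul, hr]
    · have hq : ExtVanishes R W (QuotSMulTop r Y) i :=
        ih (fun s hs => hW s (by simp [hs])) _ h.2 i (by simpa using hi)
      refine extVanishes_of_eq_zero fun x => hS.extMap_injective_succ hq ?_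
      have : LinearMap.lsmul R Y r = r • LinearMap.id := by
        ext
        simp
      rw [this, extMap_smul, ext_smul_eq_zero hr, map_zero]

theorem localRingDepth_le_of_not_extVanishes [IsLocalRing R] {i : ℕ}
    (h : ¬ ExtVanishes R (IsLocalRing.ResidueField R) R i) : localRingDepth R ≤ i := by
  refine iSup₂_le fun rs hrs => ?_
  by_contra! hlt
  refine h (extVanishes_of_isWeaklyRegular rs (fun r hr w => ?_) R hrs.1.toIsWeaklyRegular i
    (by exact_mod_cast hlt))
  rw [Algebra.smul_def, IsLocalRing.ResidueField.algebraMap_eq,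
    (IsLocalRing.residue_eq_zero_iff r).mpr (hrs.2 r hr), zero_mul]

end Depth

/-! ### Modules of Gorenstein dimension zero -/

section GDimZero

variable {R : Type u} [CommRing R]

theorem isGDimZero_of_projective (P : Type u) [AddCommGroup P] [Module R P] [Module.Finite R P]
    [Module.Projective R P] : IsGDimZero R P where
  finite := inferInstance
  reflexive := inferInstance
  ext_eq_zero _ hi := extVanishes_of_projective R _ _ hi
  ext_dual_eq_zero _ hi := extVanishes_of_projective R (Module.Dual R P) _ hi

variable {X Y Z : Type u} [AddCommGroup X] [Module R X] [AddCommGroup Y] [Module R Y]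
  [AddCommGroup Z] [Module R Z] {f : X →ₗ[R] Y} {g : Y →ₗ[R] Z}

/-- The vanishing of `Ext^1(X*, R)` keeps the bidual sequence exact on the right; a diagram chase
against the original sequence finishes. -/
theorem IsShortExact.isReflexive_right (h : IsShortExact f g) [Module.IsReflexive R X]
    [Module.IsReflexive R Y] (hf : Function.Surjective f.dualMap)
    (hX : ExtVanishes R (Module.Dual R X) R 1) : Module.IsReflexive R Z := by
  have h2 := (h.dual hf).dual fun φ => (h.dual hf).exists_extension hX φ
  have hg : ∀ y, Module.Dual.eval R Z (g y) = g.dualMap.dualMap (Module.Dual.eval R Y y) :=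
    fun _ => rfl
  have hf : ∀ x, Module.Dual.eval R Y (f x) = f.dualMap.dualMap (Module.Dual.eval R X x) :=
    fun _ => rfl
  refine ⟨(injective_iff_map_eq_zero _).mpr fun z hz => ?_, fun ξ => ?_⟩
  · obtain ⟨y, rfl⟩ := h.surjective z
    rw [hg, h2.exact] at hz
    obtain ⟨a, ha⟩ := hz
    obtain ⟨x, rfl⟩ := (Module.bijective_dual_eval R X).2 a
    rw [← hf] at ha
    rw [← (Module.bijective_dual_eval R Y).1 ha, h.exact.apply_apply_eq_zero]
  · obtain ⟨η, rfl⟩ := h2.surjective ξ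
    obtain ⟨y, rfl⟩ := (Module.bijective_dual_eval R Y).2 η
    exact ⟨g y, hg y⟩

theorem IsShortExact.isGDimZero_right (h : IsShortExact f g) (hX : IsGDimZero R X)
    (hY : IsGDimZero R Y) (hf : Function.Surjective f.dualMap) : IsGDimZero R Z where
  finite := by
    have := hY.finite
    exact h.finite_right
  reflexive := by
    have := hX.reflexive
    have := hY.reflexive
    exact h.isReflexive_right hf (hX.ext_dual_eq_zero 1 le_rfl)
  ext_eq_zero i hi := by
    obtain ⟨i, rfl⟩ := Nat.exists_eq_add_of_le' hi
    rcases i with _ | i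
    · exact h.extVanishes_one_right (hY.ext_eq_zero 1 le_rfl) hf
    · exact h.extVanishes_right_of_left_of_middle (hX.ext_eq_zero _ (by lia))
        (hY.ext_eq_zero _ (by lia))
  ext_dual_eq_zero i hi :=
    (h.dual hf).extVanishes_left_of_middle_of_right (hY.ext_dual_eq_zero i hi)
      (hX.ext_dual_eq_zero _ (by lia))

theorem IsGDimZero.exists_isPushforward [IsNoetherianRing R] {G : ModuleCat.{u} R}
    (hG : IsGDimZero R G) : ∃ (F N : ModuleCat.{u} R) (f : G →ₗ[R] F) (g : F →ₗ[R] N),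
      IsPushforward f g ∧ IsGDimZero R N := by
  have := hG.finite
  have := hG.reflexive
  obtain ⟨F, N, f, g, h⟩ := _root_.exists_isPushforward G (Module.bijective_dual_eval R G).1
  have := h.finite
  have := h.projective
  exact ⟨F, N, f, g, h, h.isGDimZero_right hG (isGDimZero_of_projective F) h.dual_surjective⟩

theorem IsGDimZero.hasPushforwards [IsNoetherianRing R] (k : ℕ) : ∀ {G : ModuleCat.{u} R},
    IsGDimZero R G → HasPushforwards R k G := by
  induction k with
  | zero => exact fun _ => trivial
  | succ k ih =>
    intro G hG
    obtain ⟨F, N, f, g, h, hN⟩ := hG.exists_isPushforward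
    exact ⟨F, N, f, g, h, ih hN⟩

end GDimZero

/-! ### Finite Gorenstein dimension over a local ring -/

section Local

variable {R : Type u} [CommRing R] {W : Type u} [AddCommGroup W] [Module R W] {d : ℕ}

theorem IsShortExact.extMap_injective {X Y Z : Type u} [AddCommGroup X] [Module R X]
    [AddCommGroup Y] [Module R Y] [AddCommGroup Z] [Module R Z] {f : X →ₗ[R] Y} {g : Y →ₗ[R] Z}
    (h : IsShortExact f g) (hZ : ∀ i < d, ExtVanishes R W Z i) :
    Function.Injective (extMap W d f) := by
  rcases d with _ | d
  · exact extMap_injective_zero h.injective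
  · exact h.extMap_injective_succ (hZ d (by lia))

open IsLocalRing in
/-- A proper submodule of a finite module over a local ring is annihilated by a nonzero map to any
module with a nonzero element killed by the maximal ideal. -/
theorem exists_ne_zero_of_range_ne_top {X Y V : Type*} [AddCommGroup X] [Module R X]
    [AddCommGroup Y] [Module R Y] [AddCommGroup V] [Module R V] [IsLocalRing R]
    [Module.Finite R Y]
    (f : X →ₗ[R] Y) (hf : ¬ Function.Surjective f) (v : V) (hv : v ≠ 0)
    (hm : ∀ r ∈ maximalIdeal R, r • v = 0) : ∃ ψ : Y →ₗ[R] V, ψ ≠ 0 ∧ ψ ∘ₗ f = 0 := by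
  obtain h | ⟨N, hN, hle⟩ := eq_top_or_exists_le_coatom (LinearMap.range f)
  · exact absurd (LinearMap.range_eq_top.mp h) hf
  have : IsSimpleModule R (Y ⧸ N) := isSimpleModule_iff_isCoatom.mpr hN
  obtain ⟨I, hI, ⟨e⟩⟩ := isSimpleModule_iff_quot_maximal.mp this
  obtain rfl := eq_maximalIdeal hI
  let a : (R ⧸ maximalIdeal R) →ₗ[R] V :=
    (maximalIdeal R).liftQ (LinearMap.toSpanSingleton R V v) fun r hr => hm r hr
  refine ⟨a ∘ₗ e.toLinearMap ∘ₗ N.mkQ, fun h => hv ?_, ?_⟩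
  · obtain ⟨y, hy⟩ := N.mkQ_surjective (e.symm (Submodule.Quotient.mk 1))
    have := LinearMap.congr_fun h y
    simp only [LinearMap.comp_apply, hy, LinearEquiv.coe_coe, LinearEquiv.apply_symm_apply,
      LinearMap.zero_apply] at this
    rw [← this]
    exact (one_smul R v).symm
  · ext x
    have : N.mkQ (f x) = 0 := (Submodule.Quotient.mk_eq_zero N).mpr (hle ⟨x, rfl⟩)
    simp only [LinearMap.comp_apply, this, map_zero, LinearMap.zero_apply]

variable [IsNoetherianRing R]

theorem IsGDimZero.forall_extVanishes {G : ModuleCat.{u} R} (hG : IsGDimZero R G)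
    (hd : ∀ i < d, ExtVanishes R W R i) : ∀ i < d, ExtVanishes R W G i :=
  (hG.hasPushforwards d).hasCosyzygies.extVanishes hd

/-- The pushforward cokernel `N` again has Gorenstein dimension zero, so `Ext^d(W, G)` injects into
`Ext^d(W, F)`, where forms detect elements. With the next lemma this gives `Ext^d(W, G) ≅ Hom(G*,
Ext^d(W, R))`. -/
theorem IsGDimZero.eq_zero_of_forall_extMap_eq_zero {G : ModuleCat.{u} R} (hG : IsGDimZero R G)
    (hd : ∀ i < d, ExtVanishes R W R i)
    (x : Abelian.Ext.{u} (ModuleCat.of R W) (ModuleCat.of R G) d)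
    (hx : ∀ φ : G →ₗ[R] R, extMap W d φ x = 0) : x = 0 := by
  obtain ⟨F, N, f, g, h, hN⟩ := hG.exists_isPushforward
  have := h.finite
  have := h.projective
  refine h.extMap_injective (hN.forall_extVanishes hd) ?_
  rw [map_zero]
  refine _root_.eq_zero_of_forall_extMap_eq_zero (P := F) _ fun φ => ?_
  rw [← extMap_comp]
  exact hx _

theorem IsGDimZero.exists_forall_extMap_eq {G : ModuleCat.{u} R} (hG : IsGDimZero R G)
    (hd : ∀ i < d, ExtVanishes R W R i)
    (ψ : Module.Dual R G →ₗ[R] Abelian.Ext.{u} (ModuleCat.of R W) (ModuleCat.of R R) d) :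
    ∃ x : Abelian.Ext.{u} (ModuleCat.of R W) (ModuleCat.of R G) d,
      ∀ φ : G →ₗ[R] R, extMap W d φ x = ψ φ := by
  obtain ⟨F, N, f, g, h, hN⟩ := hG.exists_isPushforward
  have := h.finite
  have := h.projective
  obtain ⟨y, hy⟩ := _root_.exists_forall_extMap_eq (P := F) (ψ ∘ₗ f.dualMap)
  -- Forms on `N` pull back to forms on `F` vanishing on `G`, so they kill `g_* y`; hence `y` lifts
  -- to `Ext^d(W, G)`.
  have hgy : extMap W d g y = 0 := by
    refine hN.eq_zero_of_forall_extMap_eq_zero hd _ fun χ => ?_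
    have h0 : (χ ∘ₗ g) ∘ₗ f = 0 := by
      rw [LinearMap.comp_assoc, h.exact.linearMap_comp_eq_zero, LinearMap.comp_zero]
    rw [← extMap_comp, hy, LinearMap.comp_apply, LinearMap.dualMap_apply', h0, map_zero]
  obtain ⟨x, rfl⟩ := (h.extMap_exact d y).mp hgy
  refine ⟨x, fun φ => ?_⟩
  obtain ⟨φ, rfl⟩ := h.dual_surjective φ
  rw [LinearMap.dualMap_apply', extMap_comp, hy]
  rfl

variable [IsLocalRing R]

/-- If the cokernel of `G₁ → G₀` is deep, then every linear form on `G₁` extends to `G₀`. -/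
theorem IsShortExact.dual_surjective_of_isGDimZero {G₁ G₀ X : ModuleCat.{u} R} {f : G₁ →ₗ[R] G₀}
    {g : G₀ →ₗ[R] X} (h : IsShortExact f g) (h₁ : IsGDimZero R G₁) (h₀ : IsGDimZero R G₀)
    (hd : ∀ i < d, ExtVanishes R (IsLocalRing.ResidueField R) R i)
    (hd' : ¬ ExtVanishes R (IsLocalRing.ResidueField R) R d)
    (hX : ∀ i < d, ExtVanishes R (IsLocalRing.ResidueField R) X i) :
    Function.Surjective f.dualMap := by
  by_contra hf
  have := h₁.finite
  have : Module.Finite R (Module.Dual R G₁) := Module.IsNoetherian.finite R (G₁ →ₗ[R] R)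
  obtain ⟨v, hv⟩ : ∃ v : Abelian.Ext.{u} (ModuleCat.of R (IsLocalRing.ResidueField R))
      (ModuleCat.of R R) d, v ≠ 0 := by
    by_contra! hv
    exact hd' (extVanishes_of_eq_zero hv)
  -- A nonzero `ψ : G₁* → Ext^d(κ, R)` killing the image of `G₀*` comes from a class `x` in
  -- `Ext^d(κ, G₁)`. Its image in `Ext^d(κ, G₀)` is zero, contradicting injectivity there.
  obtain ⟨ψ, hψ, hψf⟩ := exists_ne_zero_of_range_ne_top f.dualMap hf v hv fun r hr =>
    ext_smul_eq_zero (fun w => by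
      rw [Algebra.smul_def, IsLocalRing.ResidueField.algebraMap_eq,
        (IsLocalRing.residue_eq_zero_iff r).mpr hr, zero_mul]) v
  obtain ⟨x, hx⟩ := h₁.exists_forall_extMap_eq hd ψ
  have hfx : extMap _ d f x = 0 := h₀.eq_zero_of_forall_extMap_eq_zero hd _ fun φ => by
    rw [← extMap_comp, hx]
    exact LinearMap.congr_fun hψf φ
  have hx0 : x = 0 := h.extMap_injective hX (by rw [hfx, map_zero])
  exact hψ (LinearMap.ext fun φ => by rw [← hx, hx0, map_zero, LinearMap.zero_apply])

/-- Over a local ring whose first nonvanishing `Ext^i(κ, R)` is in degree `d`, a module of finite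
Gorenstein dimension with `Ext^i(κ, X) = 0` for `i < d` has Gorenstein dimension zero. -/
theorem isGDimZero_of_gDimLE (hd : ∀ i < d, ExtVanishes R (IsLocalRing.ResidueField R) R i)
    (hd' : ¬ ExtVanishes R (IsLocalRing.ResidueField R) R d) {n : ℕ} : ∀ {X : ModuleCat.{u} R},
    GDimLE R X n → (∀ i < d, ExtVanishes R (IsLocalRing.ResidueField R) X i) →
      IsGDimZero R X := by
  induction n with
  | zero =>
    rintro X ⟨G, δ, ε, hG, hG', hε, hδε, -⟩ -
    -- As `G 1 = 0`, the map `ε` is an isomorphism; reading it as a quotient by zero transfers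
    -- Gorenstein dimension zero to `X`.
    have := hG' 1 (by lia)
    have h : IsShortExact (δ 0) ε := ⟨Function.injective_of_subsingleton _, hδε, hε⟩
    have : Subsingleton (Module.Dual R (G 1)) :=
      ⟨fun a b => LinearMap.ext fun x => by rw [Subsingleton.elim x 0, map_zero, map_zero]⟩
    exact h.isGDimZero_right (isGDimZero_of_projective _) (hG 0 le_rfl)
      (Function.surjective_to_subsingleton _)
  | succ n ih =>
    rintro X ⟨G, δ, ε, hG, hG', hε, hδε, hδ⟩ hX
    have h := isShortExact_ker_subtype hε
    have h₀ := hG 0 (by lia)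
    have hK : ∀ i < d, ExtVanishes R (IsLocalRing.ResidueField R) (LinearMap.ker ε) i :=
      h.forall_extVanishes_left (h₀.forall_extVanishes hd) fun i hi => hX i (by lia)
    have hK0 : IsGDimZero R (ModuleCat.of R (LinearMap.ker ε)) := by
      refine ih (X := ModuleCat.of R (LinearMap.ker ε)) ⟨fun j => G (j + 1), fun j => δ (j + 1),
        (δ 0).codRestrict (LinearMap.ker ε) fun x => hδε.apply_apply_eq_zero x,
        fun j hj => hG _ (by lia), fun j hj => hG' _ (by lia), ?_, ?_, fun j => hδ _⟩ hK
      · rintro ⟨y, hy⟩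
        obtain ⟨x, rfl⟩ := (hδε y).mp hy
        exact ⟨x, rfl⟩
      · intro x
        rw [Subtype.ext_iff]
        exact hδ 0 x
    exact h.isGDimZero_right hK0 h₀ (IsShortExact.dual_surjective_of_isGDimZero
      (G₁ := ModuleCat.of R (LinearMap.ker ε)) h hK0 h₀ hd hd' hX)

end Local

/-! ### Localization of the chains -/

section Localize

variable {R : Type u} [CommRing R] (S : Submonoid R)

/-- The localization of a module, as a bundled module. -/
noncomputable abbrev localizedCat (M : ModuleCat.{u} R) : ModuleCat.{u} (Localization S) :=
  ModuleCat.of (Localization S) (LocalizedModule S M)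

variable {X Y Z : Type u} [AddCommGroup X] [Module R X] [AddCommGroup Y] [Module R Y]
  [AddCommGroup Z] [Module R Z]

theorem IsShortExact.localized {f : X →ₗ[R] Y} {g : Y →ₗ[R] Z} (h : IsShortExact f g) :
    IsShortExact (LocalizedModule.map S f) (LocalizedModule.map S g) where
  injective := LocalizedModule.map_injective S f h.injective
  exact := LocalizedModule.map_exact S f g h.exact
  surjective := LocalizedModule.map_surjective S g h.surjective

theorem localizedModule_hom_ext {N : Type*} [AddCommGroup N] [Module (Localization S) N]
    {a b : LocalizedModule S X →ₗ[Localization S] N}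
    (h : ∀ x : X, a (LocalizedModule.mk x 1) = b (LocalizedModule.mk x 1)) : a = b := by
  ext x
  induction x using LocalizedModule.induction_on with
  | h x s =>
    have hx : LocalizedModule.mk x s = Localization.mk 1 s • LocalizedModule.mk x (1 : S) := by
      rw [LocalizedModule.mk_smul_mk, one_smul, mul_one]
    rw [hx, map_smul, map_smul, h]

/-- Up to a unit, linear forms on a localization come from linear forms. -/
theorem exists_dual_lift [IsNoetherianRing R] [Module.Finite R X]
    (φ : LocalizedModule S X →ₗ[Localization S] Localization S) :
    ∃ (h : X →ₗ[R] R) (s : S), ∀ x, algebraMap R (Localization S) (h x) =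
      algebraMap R (Localization S) s * φ (LocalizedModule.mk x 1) := by
  have := Module.finitePresentation_of_finite R X
  obtain ⟨h, s, hs⟩ := Module.FinitePresentation.exists_lift_of_isLocalizedModule S
    (Algebra.linearMap R (Localization S))
    (φ.restrictScalars R ∘ₗ LocalizedModule.mkLinearMap S X)
  refine ⟨h, s, fun x => ?_⟩
  have := LinearMap.congr_fun hs x
  rw [← Algebra.smul_def]
  exact this

theorem IsPushforward.localized [IsNoetherianRing R] [Module.Finite R X] {f : X →ₗ[R] Y}
    {g : Y →ₗ[R] Z} (h : IsPushforward f g) :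
    IsPushforward (LocalizedModule.map S f) (LocalizedModule.map S g) := by
  have := h.finite
  have := h.projective
  refine { h.toIsShortExact.localized S with
    finite := inferInstance
    projective := inferInstance
    dual_surjective := fun φ => ?_ }
  -- Clear the denominator `s`, extend the form over `R`, then divide by `s` again.
  obtain ⟨χ, s, hχ⟩ := exists_dual_lift S φ
  obtain ⟨χ, rfl⟩ := h.dual_surjective χ
  let χ' : LocalizedModule S Y →ₗ[Localization S] Localization S :=
    IsLocalizedModule.mapExtendScalars S (LocalizedModule.mkLinearMap S Y)
      (Algebra.linearMap R (Localization S)) (Localization S) χ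
  have hχ' : ∀ y, χ' (LocalizedModule.mk y 1) = algebraMap R (Localization S) (χ y) := fun y =>
    IsLocalizedModule.map_apply S (LocalizedModule.mkLinearMap S Y)
      (Algebra.linearMap R (Localization S)) χ y
  refine ⟨Localization.mk 1 s • χ', localizedModule_hom_ext S fun x => ?_⟩
  rw [LinearMap.dualMap_apply, LocalizedModule.map_mk, LinearMap.smul_apply, hχ']
  have := hχ x
  rw [LinearMap.dualMap_apply] at this
  rw [this, smul_eq_mul, ← mul_assoc, ← Localization.mk_one_eq_algebraMap, Localization.mk_mul]
  simp [Localization.mk_self]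

theorem HasCosyzygies.localized {k : ℕ} : ∀ {M : ModuleCat.{u} R}, HasCosyzygies R k M →
    HasCosyzygies (Localization S) k (localizedCat S M) := by
  induction k with
  | zero => exact fun _ => trivial
  | succ k ih =>
    rintro M ⟨F, N, f, g, h, _, _, hN⟩
    exact ⟨localizedCat S F, localizedCat S N, _, _, h.localized S,
      inferInstanceAs (Module.Finite _ (LocalizedModule S F)),
      inferInstanceAs (Module.Projective _ (LocalizedModule S F)), ih hN⟩

theorem HasResolution.localized {j : ℕ} : ∀ {L : ModuleCat.{u} R}, HasResolution R j L →
    HasResolution (Localization S) j (localizedCat S L) := by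
  induction j with
  | zero =>
    intro L hL
    have : Subsingleton L := hL
    refine ⟨fun a b => ?_⟩
    induction a, b using LocalizedModule.induction_on₂ with
    | h x y s t => rw [Subsingleton.elim x 0, Subsingleton.elim y 0, LocalizedModule.zero_mk,
        LocalizedModule.zero_mk]
  | succ j ih =>
    rintro L ⟨K, F, f, g, h, _, _, hK⟩
    exact ⟨localizedCat S K, localizedCat S F, _, _, h.localized S,
      inferInstanceAs (Module.Finite _ (LocalizedModule S F)),
      inferInstanceAs (Module.Projective _ (LocalizedModule S F)), ih hK⟩

end Localize

/-! ### Associated primes and `Hom(κ(P), -)` -/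

section AssociatedPrime

variable {R : Type u} [CommRing R]

/-- If the prime `P` is the annihilator of `l`, then `Hom(κ(P), L_P) ≠ 0`. -/
theorem not_extVanishes_zero_of_annihilator (P : Ideal R) [P.IsPrime] {L : Type u}
    [AddCommGroup L] [Module R L] (l : L) (hl : ∀ r : R, r ∈ P ↔ r • l = 0) :
    ¬ ExtVanishes (Localization.AtPrime P) (IsLocalRing.ResidueField (Localization.AtPrime P))
      (LocalizedModule P.primeCompl L) 0 := by
  intro h
  rw [extVanishes_zero_iff] at h
  let m : LocalizedModule P.primeCompl L := LocalizedModule.mk l 1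
  have hle : IsLocalRing.maximalIdeal (Localization.AtPrime P) ≤
      LinearMap.ker (LinearMap.toSpanSingleton (Localization.AtPrime P) _ m) := by
    rw [← Localization.AtPrime.map_eq_maximalIdeal, Ideal.map_le_iff_le_comap]
    intro r hr
    rw [Ideal.mem_comap, LinearMap.mem_ker, LinearMap.toSpanSingleton_apply,
      ← Localization.mk_one_eq_algebraMap, LocalizedModule.mk_smul_mk, (hl r).mp hr,
      LocalizedModule.zero_mk]
  let a : IsLocalRing.ResidueField (Localization.AtPrime P) →ₗ[Localization.AtPrime P]
      LocalizedModule P.primeCompl L := Submodule.liftQ _ _ hle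
  have hm : m = 0 := by
    have := LinearMap.congr_fun (h a) (Submodule.Quotient.mk 1)
    rw [← one_smul (Localization.AtPrime P) m]
    exact this
  obtain ⟨s, hs⟩ := (LocalizedModule.mk_eq (S := P.primeCompl) (s' := 1)).mp
    (hm.trans (LocalizedModule.zero_mk 1).symm)
  simp only [one_smul, smul_zero] at hs
  exact s.2 ((hl s).mpr hs)

end AssociatedPrime

/-! ### From syzygies to pushforwards -/

section Transfer

variable {R : Type u} [CommRing R]

theorem gDimLE_of_gDim_lt_top {X : Type v} [AddCommGroup X] [Module R X] (h : gDim R X < ⊤) :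
    ∃ n, GDimLE R X n := by
  by_contra! hn
  simp [gDim, hn] at h

theorem IsPushforward.exists_extension {M F N P : Type u} [AddCommGroup M] [Module R M]
    [AddCommGroup F] [Module R F] [AddCommGroup N] [Module R N] [AddCommGroup P] [Module R P]
    [Module.Finite R P] [Module.Projective R P] {f : M →ₗ[R] F} {g : F →ₗ[R] N}
    (h : IsPushforward f g) (φ : M →ₗ[R] P) : ∃ χ : F →ₗ[R] P, χ ∘ₗ f = φ := by
  obtain ⟨n, p, s, -, -, hps⟩ := Module.Finite.exists_comp_eq_id_of_projective R P
  choose c hc using fun j : Fin n => h.dual_surjective (LinearMap.proj j ∘ₗ s ∘ₗ φ)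
  refine ⟨p ∘ₗ LinearMap.pi c, ?_⟩
  have : LinearMap.pi c ∘ₗ f = s ∘ₗ φ := by
    ext m j
    exact LinearMap.congr_fun (hc j) m
  rw [LinearMap.comp_assoc, this, ← LinearMap.comp_assoc, hps, LinearMap.id_comp]

variable [IsNoetherianRing R]

/-- Comparison of a chain of pushforwards of `N` with a chain of projectives above `N'`: the kernel of
`N → N**` embeds into a module with a finite resolution, so its associated primes are among those
where the localizations of `N` are assumed to have all pushforwards. -/
theorem hasPushforwards_succ_of_isShortExact {t : ℕ} : ∀ {j : ℕ} {N N' Q L : ModuleCat.{u} R}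
    [Module.Finite R N] [Module.Finite R Q] [Module.Projective R Q] {a : L →ₗ[R] Q × N}
    {b : Q × N →ₗ[R] N'}, IsShortExact a b → HasResolution R j L → HasPushforwards R t N →
    HasCosyzygies R (t + 1) N' →
    (∀ (P : Ideal R) [P.IsPrime],
      (∃ i < j + t, ¬ ExtVanishes (Localization.AtPrime P)
        (IsLocalRing.ResidueField (Localization.AtPrime P)) (Localization.AtPrime P) i) →
      ∀ s, HasPushforwards (Localization.AtPrime P) s (localizedCat P.primeCompl N)) →
    HasPushforwards R (t + 1) N := by
  induction t with
  | zero =>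
    rintro j N N' Q L _ _ _ a b hab hL _ ⟨F', _, f', _, hf', _, _, _⟩ hP
    suffices hN : Function.Injective (Module.Dual.eval R N) by
      obtain ⟨F, N₁, f, g, h⟩ := exists_isPushforward N hN
      exact ⟨F, N₁, f, g, h, trivial⟩
    by_contra hN
    have : Nontrivial (LinearMap.ker (Module.Dual.eval R N)) := by
      rwa [Submodule.nontrivial_iff_ne_bot, Ne, LinearMap.ker_eq_bot]
    obtain ⟨P, hPa⟩ := associatedPrimes.nonempty R (LinearMap.ker (Module.Dual.eval R N))
    obtain ⟨hPp, ⟨n, hn⟩, hPn⟩ := Submodule.isAssociatedPrime_iff.mp hPa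
    have hPn' : ∀ r : R, r ∈ P ↔ r • n = 0 := fun r => by
      rw [hPn, Submodule.mem_colon_singleton, Submodule.mem_bot, Subtype.ext_iff]
      rfl
    have hφ : ∀ φ : N →ₗ[R] R, φ n = 0 := fun φ => LinearMap.congr_fun hn φ
    -- Forms on `F'` pull back to `N`, where all of them kill `n`; as `N'` embeds in the reflexive
    -- `F'`, the image of `n` in `N'` is zero, so `n` comes from `L`.
    have hbn : b (0, n) = 0 := by
      refine hf'.injective ((Module.bijective_dual_eval R F').1 (LinearMap.ext fun χ => ?_))
      rw [map_zero, map_zero]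
      exact hφ (χ ∘ₗ f' ∘ₗ b ∘ₗ LinearMap.inr R Q N)
    obtain ⟨l, hl⟩ := (hab.exact _).mp hbn
    have hPl : ∀ r : R, r ∈ P ↔ r • l = 0 := fun r => by
      rw [hPn', ← map_eq_zero_iff a hab.injective, map_smul, hl, Prod.smul_mk, smul_zero,
        Prod.mk_eq_zero]
      exact ⟨fun h => ⟨rfl, h⟩, And.right⟩
    have hbad : ∃ i < j + 0, ¬ ExtVanishes (Localization.AtPrime P)
        (IsLocalRing.ResidueField (Localization.AtPrime P)) (Localization.AtPrime P) i := by
      by_contra! hall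
      exact not_extVanishes_zero_of_annihilator P l hPl
        ((hL.localized P.primeCompl).extVanishes 0 fun i hi => hall i (by lia))
    obtain ⟨F, N₁, f, g, h, -⟩ := hP P hbad 1
    have h0 : (LocalizedModule.mk n 1 : LocalizedModule P.primeCompl N) = 0 := by
      refine h.eval_injective (LinearMap.ext fun φ => ?_)
      obtain ⟨χ, s, hχ⟩ := exists_dual_lift P.primeCompl φ
      have := hχ n
      rw [hφ, map_zero, eq_comm] at this
      rw [map_zero]
      exact ((IsLocalization.map_units (Localization.AtPrime P) s).mul_right_eq_zero).mp this
    obtain ⟨s, hs⟩ := (LocalizedModule.mk_eq (S := P.primeCompl) (s' := 1)).mp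
      (h0.trans (LocalizedModule.zero_mk 1).symm)
    simp only [one_smul, smul_zero] at hs
    exact s.2 ((hPn' s).mpr hs)
  | succ t ih =>
    rintro j N N' Q L _ _ _ a b hab hL ⟨F, N₁, f, g, hf, hN₁⟩
      ⟨F', N₁', f', g', hf', _, _, hN₁'⟩ hP
    have := hf.finite
    have := hf.projective
    have : Module.Finite R N₁ := hf.finite_right
    -- The pushforward property lifts `N → N'` to a map `(χ, ψ)` of the two sequences.
    obtain ⟨χ, hχ⟩ := hf.exists_extension (f' ∘ₗ b ∘ₗ LinearMap.inr R Q N)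
    have hχ' : ∀ n, χ (f n) = f' (b (0, n)) := fun n => LinearMap.congr_fun hχ n
    have hfg := hf.exact.apply_apply_eq_zero
    have hfg' := hf'.exact.apply_apply_eq_zero
    obtain ⟨ψ, hψ⟩ := exists_comp_eq_of_surjective hf.surjective (g' ∘ₗ χ) fun x hx => by
      obtain ⟨n, rfl⟩ := (hf.exact x).mp hx
      rw [LinearMap.comp_apply, hχ', hfg']
    have hψ' : ∀ x, ψ (g x) = g' (χ x) := fun x => LinearMap.congr_fun hψ x
    -- The kernel of `c` is `L` and its image is the kernel of `F' ⊕ N₁ → N₁'`. So the image serves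
    -- as the next `L`, with one more term in its resolution.
    let c : Q × F →ₗ[R] F' × N₁ :=
      ((f' ∘ₗ b ∘ₗ LinearMap.inl R Q N).coprod χ).prod (g ∘ₗ LinearMap.snd R Q F)
    have hc : ∀ q x, c (q, x) = (f' (b (q, 0)) + χ x, g x) := fun q x => rfl
    have hb : ∀ q n, b (q, n) = b (q, 0) + b (0, n) := fun q n => by
      rw [← map_add]
      simp
    let a' : L →ₗ[R] Q × F := LinearMap.prodMap LinearMap.id f ∘ₗ a
    have ha' : ∀ l, a' l = ((a l).1, f (a l).2) := fun l => rfl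
    have hK : IsShortExact a' c.rangeRestrict :=
      { injective := by
          exact (Function.Injective.prodMap Function.injective_id hf.injective).comp hab.injective
        exact := by
          rintro ⟨q, x⟩
          rw [Subtype.ext_iff]
          change c (q, x) = 0 ↔ _
          rw [hc, Prod.mk_eq_zero]
          constructor
          · rintro ⟨h1, h2⟩
            obtain ⟨n, rfl⟩ := (hf.exact x).mp h2
            rw [hχ', ← map_add, ← hb, map_eq_zero_iff f' hf'.injective] at h1
            obtain ⟨l, hl⟩ := (hab.exact _).mp h1
            exact ⟨l, by rw [ha', hl]⟩
          · rintro ⟨l, hl⟩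
            rw [ha', Prod.mk.injEq] at hl
            obtain ⟨rfl, rfl⟩ := hl
            refine ⟨?_, hfg _⟩
            rw [hχ', ← map_add, ← hb, Prod.mk.eta, hab.exact.apply_apply_eq_zero, map_zero]
        surjective := c.surjective_rangeRestrict }
    let b' : F' × N₁ →ₗ[R] N₁' := g'.coprod (-ψ)
    have hb' : ∀ p y, b' (p, y) = g' p - ψ y := fun p y => by simp [b', sub_eq_add_neg]
    have hS : IsShortExact (LinearMap.range c).subtype b' :=
      { injective := Submodule.injective_subtype _
        exact := by
          rintro ⟨p, y⟩
          rw [hb', sub_eq_zero]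
          constructor
          · intro hpy
            obtain ⟨x, rfl⟩ := hf.surjective y
            rw [hψ', ← sub_eq_zero, ← map_sub, hf'.exact] at hpy
            obtain ⟨n', hn'⟩ := hpy
            obtain ⟨⟨q, n⟩, rfl⟩ := hab.surjective n'
            -- Adding `f n` to `x` leaves `g x` unchanged and corrects the first component by `f' (b
            -- (0, n))`.
            refine ⟨⟨_, (q, x + f n), rfl⟩, ?_⟩
            change c (q, x + f n) = _
            rw [hc, map_add, map_add, hfg, add_zero, hχ']
            rw [hb, map_add, eq_sub_iff_add_eq] at hn'
            rw [← hn']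
            congr 1
            abel
          · rintro ⟨⟨_, ⟨q, x⟩, rfl⟩, hx⟩
            change c (q, x) = _ at hx
            rw [hc, Prod.mk.injEq] at hx
            obtain ⟨rfl, rfl⟩ := hx
            rw [map_add, hfg', zero_add, hψ']
        surjective := fun y => by
          obtain ⟨p, rfl⟩ := hf'.surjective y
          exact ⟨(p, 0), by rw [hb', map_zero, sub_zero]⟩ }
    -- The sum `j + t` is unchanged, so the same primes are tested throughout.
    refine ⟨F, N₁, f, g, hf, ih (j := j + 1) (Q := F')
      (L := ModuleCat.of R (LinearMap.range c)) hS ?_ hN₁ hN₁' ?_⟩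
    · exact ⟨L, ModuleCat.of R (Q × F), a', c.rangeRestrict, hK,
        inferInstanceAs (Module.Finite R (Q × F)),
        inferInstanceAs (Module.Projective R (Q × F)), hL⟩
    · rintro P _ ⟨i, hi, hi'⟩ s
      have : IsNoetherianRing (Localization.AtPrime P) :=
        IsLocalization.isNoetherianRing P.primeCompl _ inferInstance
      have : Module.Finite (Localization.AtPrime P) (localizedCat P.primeCompl N) :=
        inferInstanceAs (Module.Finite _ (LocalizedModule P.primeCompl N))
      exact (hP P ⟨i, by lia, hi'⟩ (s + 1)).of_isPushforward
        (F := localizedCat P.primeCompl F) (hf.localized P.primeCompl)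

/-- Under the hypothesis on Gorenstein dimensions, a `k`-th syzygy has `k` successive pushforwards. -/
theorem hasPushforwards_of_hasCosyzygies (M : ModuleCat.{u} R) [Module.Finite R M] (k : ℕ)
    (hM : ∀ (P : Ideal R) [P.IsPrime],
      localRingDepth (Localization.AtPrime P) + 2 ≤ (k : ℕ∞) →
      gDim (Localization.AtPrime P) (LocalizedModule P.primeCompl M) < ⊤)
    (h : HasCosyzygies R k M) : HasPushforwards R k M := by
  induction k with
  | zero => trivial
  | succ k ih =>
    have ih := ih (fun P _ hP => hM P (hP.trans (by exact_mod_cast k.le_succ))) h.of_succ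
    have hS : IsShortExact (0 : PUnit.{u + 1} →ₗ[R] PUnit.{u + 1} × M)
        (LinearMap.snd R PUnit.{u + 1} M) :=
      { injective := Function.injective_of_subsingleton _
        exact := by
          rintro ⟨q, m⟩
          simp [Prod.ext_iff, eq_comm]
        surjective := Prod.snd_surjective }
    -- Both chains start at `M`, so the comparison begins with `L = Q = 0`.
    refine hasPushforwards_succ_of_isShortExact (j := 0) (Q := ModuleCat.of R PUnit.{u + 1})
      (L := ModuleCat.of R PUnit.{u + 1}) hS (inferInstanceAs (Subsingleton PUnit)) ih h ?_
    rintro P _ hex s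
    have : IsNoetherianRing (Localization.AtPrime P) :=
      IsLocalization.isNoetherianRing P.primeCompl _ inferInstance
    classical
    obtain ⟨hdk, hd'⟩ := Nat.find_spec hex
    have hd : ∀ i < Nat.find hex, ExtVanishes (Localization.AtPrime P)
        (IsLocalRing.ResidueField (Localization.AtPrime P)) (Localization.AtPrime P) i :=
      fun i hi => by
        by_contra hi'
        exact Nat.find_min hex hi ⟨hi.trans hdk, hi'⟩
    generalize Nat.find hex = d at *
    -- Here `depth R_P ≤ d < k`, hence `depth R_P + 2 ≤ k + 1`.
    obtain ⟨n, hn⟩ := gDimLE_of_gDim_lt_top (hM P (by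
      calc localRingDepth (Localization.AtPrime P) + 2 ≤ (d : ℕ∞) + 2 := by
            gcongr
            exact localRingDepth_le_of_not_extVanishes hd'
        _ ≤ ((k + 1 : ℕ) : ℕ∞) := by
            norm_cast
            lia))
    have hX := ((h.localized P.primeCompl).mono (k := d) (by lia)).extVanishes hd
    exact (isGDimZero_of_gDimLE hd hd' (X := localizedCat P.primeCompl M) hn hX).hasPushforwards s

end Transfer

/-! ### Invariance under isomorphism, and the theorem -/

section Transport

variable {R : Type u} [CommRing R] {X : Type*} [AddCommGroup X] [Module R X] {Y : Type*}
  [AddCommGroup Y] [Module R Y]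

theorem GDimLE.of_linearEquiv {n : ℕ} (e : X ≃ₗ[R] Y) (h : GDimLE R X n) : GDimLE R Y n := by
  obtain ⟨G, d, ε, h1, h2, h3, h4, h5⟩ := h
  exact ⟨G, d, e.toLinearMap ∘ₗ ε, h1, h2, e.surjective.comp h3,
    (Function.Injective.comp_exact_iff_exact (i := e.toLinearMap) e.injective).mpr h4, h5⟩

theorem gDim_le_of_linearEquiv (e : X ≃ₗ[R] Y) : gDim R Y ≤ gDim R X :=
  le_iInf₂ fun n hn => iInf₂_le n (hn.of_linearEquiv e)

end Transport

theorem theorem41 (R : Type u) [CommRing R] [IsNoetherianRing R]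
    (M : Type v) [AddCommGroup M] [Module R M] [Module.Finite R M] (k : ℕ)
    (hM : ∀ (P : Ideal R) [P.IsPrime],
      localRingDepth (Localization.AtPrime P) + 2 ≤ (k : ℕ∞) →
      gDim (Localization.AtPrime P) (LocalizedModule P.primeCompl M) < ⊤) :
    IsKTorsionless R M k ↔ IsKthSyzygy R M k := by
  obtain ⟨n, p, hp⟩ := Module.Finite.exists_fin' R M
  -- A copy of `M` in the universe of `R`, where the chains are defined.
  let M' : ModuleCat.{u} R := ModuleCat.of R ((Fin n → R) ⧸ LinearMap.ker p)
  let e : M' ≃ₗ[R] M := p.quotKerEquivOfSurjective hp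
  have : Module.Finite R M' := Module.Finite.equiv e.symm
  constructor
  · intro h
    have h' := (isKTorsionless_iff_hasPushforwards M' k).mp (h.of_linearEquiv e.symm)
    exact h'.hasCosyzygies.isKthSyzygy.of_linearEquiv e
  · intro h
    have h' := (h.of_linearEquiv e.symm : IsKthSyzygy R M' k).hasCosyzygies
    refine IsKTorsionless.of_linearEquiv e ((isKTorsionless_iff_hasPushforwards M' k).mpr
      (hasPushforwards_of_hasCosyzygies M' k (fun P _ hP => ?_) h'))
    let eP : LocalizedModule P.primeCompl M ≃ₗ[Localization.AtPrime P]
        LocalizedModule P.primeCompl M' :=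
      LinearEquiv.ofBijective (LocalizedModule.map P.primeCompl e.symm.toLinearMap)
        ⟨LocalizedModule.map_injective _ _ e.symm.injective,
          LocalizedModule.map_surjective _ _ e.symm.surjective⟩
    exact (gDim_le_of_linearEquiv eP).trans_lt (hM P hP)
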